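/- For $p\in\{3,4\}$ let $\widehat B(\mathbb{RP}^2,p)$ be the space of all $p$-element subsets of $\mathbb{RP}^2$ such that no three of their points lie on one projective line. It is topologized as a subspace of $B(\mathbb{RP}^2,p)$, the quotient of the space of ordered $p$-tuples of pairwise distinct points of $\mathbb{RP}^2$ by the permutations of the points. Then the spaces $\widehat B(\mathbb{RP}^2,3)$ and $\widehat B(\mathbb{RP}^2,4)$ are homotopy equivalent to one another, and both are homotopy equivalent to the space of all unit cubes centred at the origin of $\mathbb{R}^3$ (with the topology of the Hausdorff metric). -/

import Mathlib

open scoped LinearAlgebra.Projectivization ContinuousMap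

/-- The quotient topology on a projective space: a set of points is open iff its preimage in
`V ∖ {0}` is open. -/
instance Projectivization.instQuotientTopology {K V : Type*} [DivisionRing K] [AddCommGroup V]
    [Module K V] [TopologicalSpace V] : TopologicalSpace (ℙ K V) :=
  TopologicalSpace.coinduced (fun v : {v : V // v ≠ 0} => Projectivization.mk K v.1 v.2)
    inferInstance

/-- Euclidean 3-space. -/
abbrev E3 : Type := EuclideanSpace ℝ (Fin 3)

/-- The real projective plane. -/
abbrev RP2 : Type := ℙ ℝ E3

/-- The configuration space `B(M, p)`: the subsets of `M` of cardinality `p`. -/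
def Conf (M : Type*) (p : ℕ) : Type _ := {s : Finset M // s.card = p}

namespace Conf

/-- The subset of cardinality `p` underlying an ordered configuration of `p` distinct points. -/
def ofOrdered {M : Type*} {p : ℕ} (f : {f : Fin p → M // Function.Injective f}) : Conf M p :=
  ⟨Finset.univ.map ⟨f.1, f.2⟩, by simp⟩

/-- `B(M, p)` is the quotient of the space of ordered configurations of `p` distinct points
(a subspace of `M ^ p`) by the permutations of the points. -/
instance instTopologicalSpace {M : Type*} [TopologicalSpace M] {p : ℕ} :
    TopologicalSpace (Conf M p) :=
  TopologicalSpace.coinduced ofOrdered inferInstance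

/-- A configuration in `RP²` is generic if no three of its points lie on one line. -/
def IsGeneric {p : ℕ} (c : Conf RP2 p) : Prop :=
  ∀ t : Finset RP2, t ⊆ c.1 → t.card = 3 → ¬ Projectivization.IsCollinear (t : Set RP2)

end Conf

/-- The space of generic `p`-configurations in `RP²`, a subspace of `B(RP², p)`. -/
abbrev GenericConf (p : ℕ) : Type := {c : Conf RP2 p // c.IsGeneric}

/-- A subset of `ℝ³` is a unit cube centred at the origin if, in the coordinates of some
orthonormal basis, it is `[-1/2, 1/2]³`. -/
def IsCentredUnitCube (S : Set E3) : Prop :=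
  ∃ b : OrthonormalBasis (Fin 3) ℝ E3, S = {x : E3 | ∀ i, |inner ℝ (b i) x| ≤ 1 / 2}

/-- The space of unit cubes centred at the origin of `ℝ³`, topologized as a subspace of the
nonempty compact subsets of `ℝ³` (the topology of the Hausdorff metric). -/
abbrev CentredUnitCubes : Type :=
  {K : TopologicalSpace.NonemptyCompacts E3 // IsCentredUnitCube (K : Set E3)}

/-! Both configuration spaces are compared with cubes by symmetric orthonormalization. Pick
representatives w_i of the lines of a generic configuration, canonical up to order and signs, and
let S be the frame operator x ↦ ∑ ⟪w_i, x⟫ w_i. It is positive definite because the w_i span, and it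
depends only on the configuration, since signs enter twice and order does not matter. The vectors
u_i = S^(-1/2) w_i then satisfy ∑ ⟪u_i, x⟫ u_i = x.

For three points, w_i is a unit vector, and independence makes the u_i orthonormal: their lines are
the axes of a cube. For four points, Cramer's rule gives representatives with ∑ w_i = 0, unique up
to a common scalar. The u_i also sum to zero, which forces their Gram matrix to be δ_ij - 1/4: their
lines are the diagonals of a cube.

Conversely, a cube determines its axes and its diagonals. Cube to configuration to cube is the
identity, as S = 1 there. The other composite moves a configuration by S^(-1/2), and the segment
from 1 to S^(-1/2) consists of positive definite operators, whose action preserves genericity; this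
is the required homotopy (`nonempty_homotopyEquiv_cubes`).

Maps are built on tuples of vectors or on orthonormal frames and descend along quotient maps.
Continuity of S^(-1/2) rests on `IsPositive.norm_sub_sq_le`. -/

section OperatorSqrt

variable {E : Type*} [NormedAddCommGroup E] [InnerProductSpace ℝ E]

/-! ### Positive operators and their square roots. -/

namespace ContinuousLinearMap

/-- Symmetric operators with positive definite quadratic form. -/
def IsPosDef (S : E →L[ℝ] E) : Prop :=
  S.IsPositive ∧ ∀ x, x ≠ 0 → 0 < (inner ℝ (S x) x : ℝ)

theorem IsPosDef.injective {S : E →L[ℝ] E} (hS : S.IsPosDef) : Function.Injective S := by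
  refine (injective_iff_map_eq_zero S).2 fun x hx => ?_
  by_contra h
  simpa [hx] using hS.2 x h

/-- The straight path from the identity to a positive definite operator. -/
theorem IsPosDef.segment {S : E →L[ℝ] E} (hS : S.IsPosDef) {t : ℝ} (h0 : 0 ≤ t) (h1 : t ≤ 1) :
    ((1 - t) • (1 : E →L[ℝ] E) + t • S).IsPosDef := by
  refine ⟨(isPositive_one.smul_of_nonneg (sub_nonneg.2 h1)).add (hS.1.smul_of_nonneg h0),
    fun x hx => ?_⟩
  have e : (inner ℝ (((1 - t) • (1 : E →L[ℝ] E) + t • S) x) x : ℝ) =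
      (1 - t) * inner ℝ x x + t * inner ℝ (S x) x := by
    simp [inner_add_left, real_inner_smul_left]
  rw [e]
  have hx1 : 0 < (inner ℝ x x : ℝ) := real_inner_self_pos.2 hx
  have hx2 := hS.2 x hx
  rcases h0.eq_or_lt with rfl | h0
  · simpa using hx1
  · nlinarith [mul_pos h0 hx2, mul_nonneg (sub_nonneg.2 h1) hx1.le]

variable [FiniteDimensional ℝ E]

theorem IsPositive.exists_mul_self_eq {S : E →L[ℝ] E} (hS : S.IsPositive) :
    ∃ P : E →L[ℝ] E, P.IsPositive ∧ P * P = S := by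
  have hsym := hS.isSymmetric
  set e := hsym.eigenvectorBasis rfl with he
  set μ := hsym.eigenvalues rfl with hμ
  have hSe : ∀ i, S (e i) = μ i • e i := fun i => by
    exact hsym.apply_eigenvectorBasis rfl i
  have hμ0 : ∀ i, 0 ≤ μ i := fun i => by
    have h := hS.inner_nonneg_left (e i)
    rw [hSe, real_inner_smul_left, real_inner_self_eq_norm_sq, e.norm_eq_one] at h
    simpa using h
  let P : E →L[ℝ] E := ∑ i, (√(μ i)) • (innerSL ℝ (e i)).smulRight (e i)
  have hP : ∀ x, P x = ∑ i, √(μ i) • (inner ℝ (e i) x : ℝ) • e i := fun x => by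
    simp [P]
  have hPe : ∀ i, P (e i) = √(μ i) • e i := fun i => by
    rw [hP, Finset.sum_eq_single i]
    · simp [e.norm_eq_one]
    · intro j _ hj
      simp [e.orthonormal.inner_eq_zero hj]
    · simp
  refine ⟨P, (ContinuousLinearMap.isPositive_iff _).2 ⟨fun x y => ?_, fun x => ?_⟩, ?_⟩
  · simp only [ContinuousLinearMap.coe_coe]
    rw [hP, hP, sum_inner, inner_sum]
    refine Finset.sum_congr rfl fun i _ => ?_
    simp only [real_inner_smul_left, real_inner_smul_right]
    rw [real_inner_comm x (e i)]
    ring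
  · rw [hP, sum_inner]
    refine Finset.sum_nonneg fun i _ => ?_
    simp only [real_inner_smul_left]
    exact mul_nonneg (Real.sqrt_nonneg _) (mul_self_nonneg _)
  · apply ContinuousLinearMap.coe_injective
    refine e.toBasis.ext fun i => ?_
    simp [hPe, hSe, smul_smul, Real.mul_self_sqrt (hμ0 i)]

/-- Parseval in an orthonormal eigenbasis, where D is diagonal. -/
theorem norm_le_of_eigenvalue_le {D : E →L[ℝ] E} (hD : (D : E →ₗ[ℝ] E).IsSymmetric) {c : ℝ}
    (hc : 0 ≤ c) (h : ∀ (l : ℝ) (x : E), ‖x‖ = 1 → D x = l • x → |l| ≤ c) : ‖D‖ ≤ c := by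
  set e := hD.eigenvectorBasis rfl with he
  set μ := hD.eigenvalues rfl with hμ
  have hDe : ∀ i, D (e i) = μ i • e i := fun i => by
    exact hD.apply_eigenvectorBasis rfl i
  refine ContinuousLinearMap.opNorm_le_bound _ hc fun x => ?_
  refine le_of_sq_le_sq ?_ (by positivity)
  rw [mul_pow, ← e.sum_sq_norm_inner_right, ← e.sum_sq_norm_inner_right, Finset.mul_sum]
  refine Finset.sum_le_sum fun i _ => ?_
  have h1 : (inner ℝ (e i) (D x) : ℝ) = μ i * inner ℝ (e i) x := by
    rw [← real_inner_smul_left, ← hDe]; exact (hD (e i) x).symm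
  rw [h1, norm_mul, mul_pow]
  gcongr
  exact h _ _ (e.norm_eq_one i) (hDe i)

/-- On a unit eigenvector x of P - Q with eigenvalue l, the form of P² - Q² equals l(⟪Px, x⟫ + ⟪Qx,
x⟫), while l = ⟪Px, x⟫ - ⟪Qx, x⟫ is at most that sum in absolute value. The estimate yields both
uniqueness and continuity of positive square roots. -/
theorem IsPositive.norm_sub_sq_le {P Q : E →L[ℝ] E} (hP : P.IsPositive) (hQ : Q.IsPositive) :
    ‖P - Q‖ ^ 2 ≤ ‖P * P - Q * Q‖ := by
  have hsym : ((P - Q : E →L[ℝ] E) : E →ₗ[ℝ] E).IsSymmetric := by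
    simpa using hP.isSymmetric.sub hQ.isSymmetric
  have key : ‖P - Q‖ ≤ √‖P * P - Q * Q‖ := by
    refine norm_le_of_eigenvalue_le hsym (Real.sqrt_nonneg _) fun l x hx hl => ?_
    refine Real.le_sqrt_of_sq_le ?_
    have h1 : (inner ℝ ((P * P - Q * Q) x) x : ℝ) = l * (inner ℝ (P x) x + inner ℝ (Q x) x) := by
      have : (P * P - Q * Q) x = P ((P - Q) x) + (P - Q) (Q x) := by simp
      rw [this, inner_add_left]
      have h2 : (inner ℝ ((P - Q) (Q x)) x : ℝ) = inner ℝ (Q x) ((P - Q) x) := hsym _ _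
      rw [h2, hl, map_smul, real_inner_smul_left, real_inner_smul_right]
      ring
    have h3 : l = inner ℝ (P x) x - inner ℝ (Q x) x := by
      rw [← inner_sub_left]
      change l = inner ℝ ((P - Q) x) x
      rw [hl, real_inner_smul_left, real_inner_self_eq_norm_sq, hx]; simp
    have h4 := hP.inner_nonneg_left x
    have h5 := hQ.inner_nonneg_left x
    have h6 : |(inner ℝ ((P * P - Q * Q) x) x : ℝ)| ≤ ‖P * P - Q * Q‖ := by
      refine (abs_real_inner_le_norm _ _).trans ?_
      simpa [hx] using (P * P - Q * Q).le_opNorm x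
    refine le_trans ?_ h6
    rw [h1, abs_mul, sq_abs, abs_of_nonneg (add_nonneg h4 h5), ← sq_abs, sq]
    refine mul_le_mul_of_nonneg_left ?_ (abs_nonneg _)
    rw [h3, abs_le]
    constructor <;> linarith
  calc ‖P - Q‖ ^ 2 ≤ √‖P * P - Q * Q‖ ^ 2 := by gcongr
    _ = _ := Real.sq_sqrt (norm_nonneg _)

open Classical in
/-- The positive square root of a positive operator (zero for other operators). -/
noncomputable def posSqrt (S : E →L[ℝ] E) : E →L[ℝ] E :=
  if h : S.IsPositive then h.exists_mul_self_eq.choose else 0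

theorem IsPositive.posSqrt {S : E →L[ℝ] E} (hS : S.IsPositive) : S.posSqrt.IsPositive := by
  rw [ContinuousLinearMap.posSqrt, dif_pos hS]; exact hS.exists_mul_self_eq.choose_spec.1

theorem IsPositive.posSqrt_mul_self {S : E →L[ℝ] E} (hS : S.IsPositive) :
    S.posSqrt * S.posSqrt = S := by
  rw [ContinuousLinearMap.posSqrt, dif_pos hS]; exact hS.exists_mul_self_eq.choose_spec.2

theorem posSqrt_one : (1 : E →L[ℝ] E).posSqrt = 1 := by
  have h := isPositive_one (𝕜 := ℝ) (E := E)
  have := h.posSqrt.norm_sub_sq_le h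
  rw [h.posSqrt_mul_self] at this
  simpa [sub_eq_zero] using this

theorem continuousOn_posSqrt : ContinuousOn posSqrt {S : E →L[ℝ] E | S.IsPositive} := by
  intro S hS
  refine tendsto_iff_norm_sub_tendsto_zero.2 ?_
  have h1 : Filter.Tendsto (fun T : E →L[ℝ] E => √‖T - S‖)
      (nhdsWithin S {S : E →L[ℝ] E | S.IsPositive}) (nhds 0) := by
    have : Continuous fun T : E →L[ℝ] E => √‖T - S‖ := by fun_prop
    simpa using (this.tendsto S).mono_left nhdsWithin_le_nhds
  refine squeeze_zero' (.of_forall fun _ => norm_nonneg _) ?_ h1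
  filter_upwards [self_mem_nhdsWithin] with T hT
  refine Real.le_sqrt_of_sq_le ?_
  have := hT.posSqrt.norm_sub_sq_le hS.posSqrt
  rwa [hT.posSqrt_mul_self, hS.posSqrt_mul_self] at this

theorem IsPosDef.isUnit {S : E →L[ℝ] E} (hS : S.IsPosDef) : IsUnit S := by
  have hb : Function.Bijective S := ⟨hS.injective,
    (LinearMap.injective_iff_surjective (f := (S : E →ₗ[ℝ] E))).1 hS.injective⟩
  exact ContinuousLinearMap.isUnit_iff_bijective.2 hb

theorem IsPosDef.posSqrt {S : E →L[ℝ] E} (hS : S.IsPosDef) : S.posSqrt.IsPosDef := by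
  have hp := hS.1.posSqrt
  refine ⟨hp, fun x hx => (hp.inner_nonneg_left x).lt_of_ne fun h => ?_⟩
  -- With Q a root of the root, a zero of the quadratic form gives ‖Q x‖² = 0, hence S x = Q⁴ x = 0.
  obtain ⟨Q, hQ, hQQ⟩ := hp.exists_mul_self_eq
  have h0 : Q x = 0 := by
    rw [← inner_self_eq_zero (𝕜 := ℝ), h, ← hQQ]
    exact (hQ.isSymmetric (Q x) x).symm
  have h1 := hS.2 x hx
  rw [← hS.1.posSqrt_mul_self, ← hQQ] at h1
  simp [h0] at h1

/-- The inverse square root of a positive definite operator. -/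
noncomputable def invSqrt (S : E →L[ℝ] E) : E →L[ℝ] E := Ring.inverse S.posSqrt

theorem IsPosDef.invSqrt {S : E →L[ℝ] E} (hS : S.IsPosDef) : S.invSqrt.IsPosDef := by
  have hu := hS.posSqrt.isUnit
  have h1 : ∀ x, S.posSqrt (S.invSqrt x) = x := fun x =>
    congrArg (fun T : E →L[ℝ] E => T x) (Ring.mul_inverse_cancel _ hu)
  have h2 : ∀ x y, (inner ℝ (S.invSqrt x) y : ℝ) = inner ℝ x (S.invSqrt y) := fun x y => by
    conv_lhs => rw [← h1 y]
    conv_rhs => rw [← h1 x]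
    exact (hS.posSqrt.1.isSymmetric _ _).symm
  have h3 : ∀ x, (inner ℝ (S.invSqrt x) x : ℝ) =
      inner ℝ (S.posSqrt (S.invSqrt x)) (S.invSqrt x) := fun x => by
    rw [h1, real_inner_comm]
  refine ⟨(ContinuousLinearMap.isPositive_iff _).2 ⟨h2, fun x => ?_⟩, fun x hx => ?_⟩
  · rw [h3]; exact hS.posSqrt.1.inner_nonneg_left _
  · rw [h3]
    refine hS.posSqrt.2 _ fun h0 => hx ?_
    rw [← h1 x, h0, map_zero]

theorem IsPosDef.invSqrt_apply_apply {S : E →L[ℝ] E} (hS : S.IsPosDef) (x : E) :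
    S.invSqrt (S (S.invSqrt x)) = x := by
  have hu := hS.posSqrt.isUnit
  have h : S.invSqrt * (S * S.invSqrt) = 1 := by
    rw [← mul_assoc]
    conv_lhs => rw [← hS.1.posSqrt_mul_self]
    rw [hS.1.posSqrt_mul_self, ContinuousLinearMap.invSqrt]
    nth_rw 2 [← hS.1.posSqrt_mul_self]
    rw [← mul_assoc, Ring.inverse_mul_cancel _ hu, one_mul, Ring.mul_inverse_cancel _ hu]
  exact congrArg (fun T : E →L[ℝ] E => T x) h

theorem invSqrt_one : (1 : E →L[ℝ] E).invSqrt = 1 := by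
  rw [invSqrt, posSqrt_one, Ring.inverse_one]

theorem continuousOn_invSqrt : ContinuousOn invSqrt {S : E →L[ℝ] E | S.IsPosDef} := by
  intro S hS
  have h1 := (continuousOn_posSqrt S hS.1).mono (fun T (hT : T.IsPosDef) => hT.1)
  obtain ⟨u, hu⟩ := hS.posSqrt.isUnit
  have h2 : ContinuousAt Ring.inverse S.posSqrt := by
    rw [← hu]; exact NormedRing.inverse_continuousAt u
  exact h2.comp_continuousWithinAt h1

end ContinuousLinearMap

end OperatorSqrt

/-! ### The projective plane as a quotient of the nonzero vectors. -/

section Projective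

/-- Nonzero vectors of Euclidean 3-space. -/
abbrev NzVec : Type := {v : E3 // v ≠ 0}

/-- The point of the projective plane spanned by a nonzero vector. -/
noncomputable def NzVec.point (v : NzVec) : RP2 := Projectivization.mk ℝ v.1 v.2

theorem NzVec.point_eq_iff {v w : NzVec} :
    v.point = w.point ↔ ∃ l : ℝˣ, l • w.1 = v.1 :=
  Projectivization.mk_eq_mk_iff ℝ _ _ v.2 w.2

/-- The saturation of an open set is the union of its rescalings. Openness matters because, unlike
bare quotient maps, open ones survive products and restriction to preimages. -/
theorem NzVec.isOpenQuotientMap_point : IsOpenQuotientMap NzVec.point where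
  surjective x := by
    induction x using Projectivization.ind with
    | h v hv => exact ⟨⟨v, hv⟩, rfl⟩
  continuous := continuous_coinduced_rng
  isOpenMap U hU := by
    change IsOpen (NzVec.point ⁻¹' (NzVec.point '' U))
    have h : NzVec.point ⁻¹' (NzVec.point '' U) = ⋃ l : ℝˣ,
        (fun v : NzVec => (⟨l • v.1, (smul_ne_zero_iff_ne l).2 v.2⟩ : NzVec)) ⁻¹' U := by
      ext v
      simp only [Set.mem_preimage, Set.mem_image, Set.mem_iUnion]
      constructor
      · rintro ⟨w, hw, h⟩
        obtain ⟨l, hl⟩ := NzVec.point_eq_iff.1 h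
        exact ⟨l, by simpa only [hl] using hw⟩
      · rintro ⟨l, hl⟩
        exact ⟨_, hl, NzVec.point_eq_iff.2 ⟨l, rfl⟩⟩
    rw [h]
    refine isOpen_iUnion fun l => hU.preimage ?_
    exact Continuous.subtype_mk (continuous_subtype_val.const_smul l) _

theorem NzVec.isCollinear_range_point_iff (v : Fin 3 → NzVec) :
    Projectivization.IsCollinear (Set.range fun i => (v i).point) ↔
      ¬ LinearIndependent ℝ fun i => (v i).1 := by
  constructor
  · rintro ⟨M, hfin, hrank, hM⟩ hli
    have hmem : ∀ i, (v i).1 ∈ M.submodule := fun i =>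
      (M.mem_submodule_iff (v i).2).2 (hM ⟨i, rfl⟩)
    have hspan : Submodule.span ℝ (Set.range fun i => (v i).1) ≤ M.submodule :=
      Submodule.span_le.2 (by rintro _ ⟨i, rfl⟩; exact hmem i)
    have := Submodule.finrank_mono hspan
    rw [finrank_span_eq_card hli] at this
    simp at this
    omega
  · intro h
    refine ⟨(Submodule.span ℝ (Set.range fun i => (v i).1)).projectivization, ?_, ?_, ?_⟩
    · rw [Projectivization.Subspace.submodule.apply_symm_apply]
      exact Module.Finite.span_of_finite _ (Set.finite_range _)
    · rw [Projectivization.Subspace.submodule.apply_symm_apply]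
      by_contra h2
      refine h (linearIndependent_iff_card_le_finrank_span.2 ?_)
      simp only [Fintype.card_fin]
      exact not_le.1 h2
    · rintro _ ⟨i, rfl⟩
      exact (Submodule.mk_mem_projectivization_iff _ (v i).2).2 (Submodule.subset_span ⟨i, rfl⟩)

end Projective

/-! ### Unordered configurations as an open quotient. -/

namespace Conf

variable {M : Type*} {p : ℕ}

theorem ofOrdered_surjective : Function.Surjective (ofOrdered (M := M) (p := p)) := by
  rintro ⟨s, hs⟩
  refine ⟨⟨fun i => (s.equivFinOfCardEq hs).symm i, fun i j h => by simpa using h⟩, ?_⟩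
  refine Subtype.ext (Finset.ext fun x => ?_)
  simp only [ofOrdered, Finset.mem_map, Finset.mem_univ, true_and, Function.Embedding.coeFn_mk]
  constructor
  · rintro ⟨i, rfl⟩; exact Subtype.prop _
  · intro hx; exact ⟨s.equivFinOfCardEq hs ⟨x, hx⟩, by simp⟩

theorem mem_ofOrdered {f : {f : Fin p → M // Function.Injective f}} {x : M} :
    x ∈ (ofOrdered f).1 ↔ ∃ i, f.1 i = x := by
  simp [ofOrdered]

theorem ofOrdered_eq_iff {f g : {f : Fin p → M // Function.Injective f}} :
    ofOrdered f = ofOrdered g ↔ ∃ σ : Equiv.Perm (Fin p), f.1 = g.1 ∘ σ := by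
  constructor
  · intro h
    have h1 : ∀ i, ∃ j, g.1 j = f.1 i := fun i => by
      rw [← mem_ofOrdered, ← h, mem_ofOrdered]; exact ⟨i, rfl⟩
    choose σ hσ using h1
    have hinj : Function.Injective σ := fun i j hij => f.2 (by rw [← hσ, ← hσ, hij])
    exact ⟨Equiv.ofBijective σ (Finite.injective_iff_bijective.1 hinj),
      funext fun i => (hσ i).symm⟩
  · rintro ⟨σ, h⟩
    refine Subtype.ext (Finset.ext fun x => ?_)
    rw [mem_ofOrdered, mem_ofOrdered, h]
    exact ⟨fun ⟨i, hi⟩ => ⟨σ i, hi⟩, fun ⟨i, hi⟩ => ⟨σ.symm i, by simpa using hi⟩⟩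

theorem isOpenQuotientMap_ofOrdered [TopologicalSpace M] :
    IsOpenQuotientMap (ofOrdered (M := M) (p := p)) where
  surjective := ofOrdered_surjective
  continuous := continuous_coinduced_rng
  isOpenMap U hU := by
    change IsOpen (ofOrdered ⁻¹' (ofOrdered '' U))
    have h : (ofOrdered (M := M) (p := p)) ⁻¹' (ofOrdered '' U) =
        ⋃ σ : Equiv.Perm (Fin p), (fun f : {f : Fin p → M // Function.Injective f} =>
          (⟨f.1 ∘ σ, f.2.comp σ.injective⟩ : {f : Fin p → M // Function.Injective f})) ⁻¹' U := by
      ext f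
      simp only [Set.mem_preimage, Set.mem_image, Set.mem_iUnion]
      constructor
      · rintro ⟨g, hg, h⟩
        obtain ⟨σ, hσ⟩ := ofOrdered_eq_iff.1 h
        exact ⟨σ, by simpa only [← hσ] using hg⟩
      · rintro ⟨σ, hσ⟩
        exact ⟨_, hσ, ofOrdered_eq_iff.2 ⟨σ, rfl⟩⟩
    rw [h]
    refine isOpen_iUnion fun σ => hU.preimage ?_
    refine Continuous.subtype_mk (continuous_pi fun i => ?_) _
    exact (continuous_apply (σ i)).comp continuous_subtype_val

end Conf

/-! ### Tuples of vectors spanning generic configurations. -/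

/-- The configuration of points spanned by an ordered tuple of nonzero vectors. -/
noncomputable def spanConf (p : ℕ) : {a : Fin p → NzVec // Function.Injective fun i => (a i).point} →
    Conf RP2 p :=
  Conf.ofOrdered ∘ Set.restrictPreimage {f | Function.Injective f} (Pi.map fun _ => NzVec.point)

/-- Ordered tuples of nonzero vectors spanning a generic configuration. -/
abbrev GenVec (p : ℕ) : Type := spanConf p ⁻¹' {c | c.IsGeneric}

namespace GenVec

variable {p : ℕ}

/-- The vectors of a generic tuple. -/
def vec (a : GenVec p) (i : Fin p) : E3 := (a.1.1 i).1

theorem vec_ne_zero (a : GenVec p) (i : Fin p) : a.vec i ≠ 0 := (a.1.1 i).2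

/-- The generic configuration spanned by a generic tuple of vectors. -/
noncomputable def conf (a : GenVec p) : GenericConf p := Set.restrictPreimage _ (spanConf p) a

theorem isOpenQuotientMap_conf : IsOpenQuotientMap (conf (p := p)) := by
  refine IsOpenQuotientMap.restrictPreimage ?_ _
  exact Conf.isOpenQuotientMap_ofOrdered.comp
    ((IsOpenQuotientMap.piMap fun _ => NzVec.isOpenQuotientMap_point).restrictPreimage _)

theorem continuous_vec (i : Fin p) : Continuous fun a : GenVec p => a.vec i :=
  continuous_subtype_val.comp ((continuous_apply i).comp
    (continuous_subtype_val.comp continuous_subtype_val))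

theorem mem_conf {a : GenVec p} {x : RP2} :
    x ∈ a.conf.1.1 ↔ ∃ i, Projectivization.mk ℝ (a.vec i) (a.vec_ne_zero i) = x :=
  Conf.mem_ofOrdered

theorem linearIndependent (a : GenVec p) {e : Fin 3 → Fin p} (he : Function.Injective e) :
    LinearIndependent ℝ fun i => a.vec (e i) := by
  by_contra h
  have hinj : Function.Injective fun i => (a.1.1 (e i)).point := a.1.2.comp he
  refine a.2 (Finset.univ.map ⟨_, hinj⟩) ?_ (by simp) ?_
  · intro x hx
    simp only [Finset.mem_map, Finset.mem_univ, true_and, Function.Embedding.coeFn_mk] at hx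
    obtain ⟨i, rfl⟩ := hx
    exact Conf.mem_ofOrdered.2 ⟨e i, rfl⟩
  · rw [Finset.coe_map, Finset.coe_univ, Set.image_univ]
    exact (NzVec.isCollinear_range_point_iff fun i => a.1.1 (e i)).2 h

/-- Any two indices among at least three can be completed to three distinct indices. -/
theorem _root_.Fin.exists_injective_three (hp : 3 ≤ p) {i j : Fin p} (hij : i ≠ j) :
    ∃ e : Fin 3 → Fin p, Function.Injective e ∧ e 0 = i ∧ e 1 = j := by
  obtain ⟨k, hk⟩ : ∃ k, k ∉ ({i, j} : Finset (Fin p)) := by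
    by_contra! h
    have := Finset.card_le_card (fun x _ => h x : (Finset.univ : Finset (Fin p)) ⊆ {i, j})
    have h2 := Finset.card_le_two (a := i) (b := j)
    simp at this
    omega
  simp only [Finset.mem_insert, Finset.mem_singleton, not_or] at hk
  refine ⟨![i, j, k], ?_, rfl, rfl⟩
  intro x y
  fin_cases x <;> fin_cases y <;> simp [hij, hij.symm, hk.1, hk.2, Ne.symm hk.1, Ne.symm hk.2]

/-- Independence of triples already gives distinct points: for p ≥ 3 any two indices extend to a
triple, so no two vectors are proportional. -/
theorem exists_vec_eq (hp : 3 ≤ p) (v : Fin p → E3)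
    (hv : ∀ e : Fin 3 → Fin p, Function.Injective e → LinearIndependent ℝ fun i => v (e i)) :
    ∃ a : GenVec p, a.vec = v := by
  have hpair : ∀ i j, i ≠ j → LinearIndependent ℝ ![v i, v j] := fun i j hij => by
    obtain ⟨e, he, rfl, rfl⟩ := Fin.exists_injective_three hp hij
    have := (hv e he).comp ![0, 1] (by decide)
    convert this using 1
    ext x; fin_cases x <;> rfl
  have h0 : ∀ i, v i ≠ 0 := fun i => by
    have : Nontrivial (Fin p) := Fin.nontrivial_iff_two_le.2 (by omega)
    obtain ⟨j, hj⟩ := exists_ne i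
    exact (hpair i j hj.symm).ne_zero 0
  let w : Fin p → NzVec := fun i => ⟨v i, h0 i⟩
  have hinj : Function.Injective fun i => (w i).point := fun i j hij => by
    by_contra hne
    obtain ⟨l, hl⟩ := NzVec.point_eq_iff.1 hij
    have h2 := LinearIndependent.pair_iff.1 (hpair i j hne) 1 (-l.1)
      (by rw [one_smul, neg_smul]; change v i + -(l • v j) = 0; rw [show l • v j = v i from hl]; simp)
    exact one_ne_zero h2.1
  refine ⟨⟨⟨w, hinj⟩, ?_⟩, rfl⟩
  intro t ht hcard hcol
  let e' := (t.equivFinOfCardEq hcard).symm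
  have hmem : ∀ k, ∃ i, (w i).point = (e' k).1 := fun k => Conf.mem_ofOrdered.1 (ht (e' k).2)
  choose e he using hmem
  have hei : Function.Injective e := fun k l hkl => by
    apply e'.injective
    apply Subtype.ext
    rw [← he, ← he, hkl]
  refine (NzVec.isCollinear_range_point_iff fun k => w (e k)).1 ?_ (hv e hei)
  refine Projectivization.isCollinear_subset _ _ ?_ hcol
  rintro _ ⟨k, rfl⟩
  simp only [he]
  exact (e' k).2

theorem ext {a b : GenVec p} (h : a.vec = b.vec) : a = b := by
  refine Subtype.ext (Subtype.ext (funext fun i => Subtype.ext ?_))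
  exact congrFun h i

theorem continuous_iff {X : Type*} [TopologicalSpace X] {f : X → GenVec p} :
    Continuous f ↔ ∀ i, Continuous fun x => (f x).vec i := by
  refine ⟨fun h i => (continuous_vec i).comp h, fun h => ?_⟩
  refine continuous_induced_rng.2 (continuous_induced_rng.2 (continuous_pi fun i => ?_))
  exact continuous_induced_rng.2 (h i)

theorem conf_eq_iff {a b : GenVec p} : a.conf = b.conf ↔
    ∃ (σ : Equiv.Perm (Fin p)) (l : Fin p → ℝˣ), ∀ i, a.vec i = l i • b.vec (σ i) := by
  have h1 : a.conf = b.conf ↔ spanConf p a.1 = spanConf p b.1 := Subtype.ext_iff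
  rw [h1]
  refine Conf.ofOrdered_eq_iff.trans ?_
  refine exists_congr fun σ => ?_
  refine funext_iff.trans (Iff.trans ?_
    (Classical.skolem (p := fun i (l : ℝˣ) => a.vec i = l • b.vec (σ i))))
  exact forall_congr' fun i => NzVec.point_eq_iff.trans (exists_congr fun l => eq_comm)

theorem exists_vec_eq_apply (hp : 3 ≤ p) (T : {T : E3 →L[ℝ] E3 // Function.Injective T})
    (a : GenVec p) : ∃ b : GenVec p, b.vec = fun i => T.1 (a.vec i) :=
  exists_vec_eq hp _ fun _ he =>
    (a.linearIndependent he).map' (T.1 : E3 →ₗ[ℝ] E3) (LinearMap.ker_eq_bot.2 T.2)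

/-- The image of a generic tuple under an injective operator. -/
noncomputable def act (hp : 3 ≤ p) (T : {T : E3 →L[ℝ] E3 // Function.Injective T})
    (a : GenVec p) : GenVec p :=
  (exists_vec_eq_apply hp T a).choose

theorem vec_act (hp : 3 ≤ p) (T : {T : E3 →L[ℝ] E3 // Function.Injective T}) (a : GenVec p) :
    (a.act hp T).vec = fun i => T.1 (a.vec i) :=
  (exists_vec_eq_apply hp T a).choose_spec

end GenVec

/-! ### Injective operators acting on generic configurations. -/

namespace GenericConf

variable {p : ℕ}

/-- The image of a generic configuration under an injective operator. -/
noncomputable def act (hp : 3 ≤ p) (T : {T : E3 →L[ℝ] E3 // Function.Injective T})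
    (c : GenericConf p) : GenericConf p :=
  ((Function.surjInv GenVec.isOpenQuotientMap_conf.surjective c).act hp T).conf

/-- Two lifts of a configuration differ by order and scalars, and linear maps respect both, so the
chosen lift is immaterial. -/
theorem act_conf (hp : 3 ≤ p) (T : {T : E3 →L[ℝ] E3 // Function.Injective T}) (a : GenVec p) :
    act hp T a.conf = (a.act hp T).conf := by
  obtain ⟨σ, l, h⟩ := GenVec.conf_eq_iff.1
    (Function.surjInv_eq GenVec.isOpenQuotientMap_conf.surjective a.conf)
  refine GenVec.conf_eq_iff.2 ⟨σ, l, fun i => ?_⟩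
  rw [GenVec.vec_act, GenVec.vec_act]
  simp only [h, Units.smul_def, map_smul]

theorem continuous_act (hp : 3 ≤ p) : Continuous
    fun x : {T : E3 →L[ℝ] E3 // Function.Injective T} × GenericConf p => act hp x.1 x.2 := by
  -- Openness of `GenVec.conf` keeps its product with the identity a quotient map, so continuity can
  -- be tested on vectors.
  rw [← (IsOpenQuotientMap.id.prodMap GenVec.isOpenQuotientMap_conf).continuous_comp_iff]
  have h : (fun x : {T : E3 →L[ℝ] E3 // Function.Injective T} × GenericConf p =>
      act hp x.1 x.2) ∘ Prod.map id GenVec.conf = fun x => (x.2.act hp x.1).conf :=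
    funext fun x => act_conf hp x.1 x.2
  rw [h]
  refine GenVec.isOpenQuotientMap_conf.continuous.comp (GenVec.continuous_iff.2 fun i => ?_)
  simp only [GenVec.vec_act]
  exact (continuous_subtype_val.comp continuous_fst).clm_apply
    ((GenVec.continuous_vec i).comp continuous_snd)

theorem act_one (hp : 3 ≤ p) (T : {T : E3 →L[ℝ] E3 // Function.Injective T}) (hT : T.1 = 1)
    (c : GenericConf p) : act hp T c = c := by
  obtain ⟨a, rfl⟩ := GenVec.isOpenQuotientMap_conf.surjective c
  rw [act_conf]
  congr 1
  apply GenVec.ext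
  rw [GenVec.vec_act, hT]
  rfl

end GenericConf

attribute [irreducible] GenVec.act GenericConf.act

/-! ### Orthonormal frames and the space of cubes. -/

/-- Orthonormal frames of Euclidean 3-space. -/
abbrev OrthoFrame : Type := {b : Fin 3 → E3 // Orthonormal ℝ b}

namespace OrthoFrame

/-- The orthonormal basis given by an orthonormal frame. -/
noncomputable def basis (b : OrthoFrame) : OrthonormalBasis (Fin 3) ℝ E3 :=
  (basisOfOrthonormalOfCardEqFinrank b.2 (by simp)).toOrthonormalBasis (by simpa using b.2)

theorem basis_apply (b : OrthoFrame) (i : Fin 3) : b.basis i = b.1 i := by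
  simp [basis]

theorem sum_inner_smul (b : OrthoFrame) (x : E3) :
    ∑ i, (inner ℝ (b.1 i) x : ℝ) • b.1 i = x := by
  simpa [basis_apply] using b.basis.sum_repr' x

theorem sum_sq_inner (b : OrthoFrame) (x : E3) : ∑ i, (inner ℝ (b.1 i) x : ℝ) ^ 2 = ‖x‖ ^ 2 := by
  simpa [basis_apply] using b.basis.sum_sq_norm_inner_right x

theorem inner_eq (b : OrthoFrame) (i j : Fin 3) :
    (inner ℝ (b.1 i) (b.1 j) : ℝ) = if i = j then 1 else 0 :=
  orthonormal_iff_ite.1 b.2 i j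

instance : CompactSpace OrthoFrame := by
  refine isCompact_iff_compactSpace.1 (Metric.isCompact_of_isClosed_isBounded ?_ ?_)
  · have h : {b : Fin 3 → E3 | Orthonormal ℝ b} =
        ⋂ i, ⋂ j, {b | (inner ℝ (b i) (b j) : ℝ) = if i = j then 1 else 0} := by
      ext b; simp [orthonormal_iff_ite]
    change IsClosed {b : Fin 3 → E3 | Orthonormal ℝ b}
    rw [h]
    refine isClosed_iInter fun i => isClosed_iInter fun j => isClosed_eq ?_ continuous_const
    exact (continuous_apply i).inner (continuous_apply j)
  · refine (Metric.isBounded_closedBall (x := (0 : Fin 3 → E3)) (r := 1)).subset fun b hb => ?_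
    rw [mem_closedBall_zero_iff, pi_norm_le_iff_of_nonneg zero_le_one]
    exact fun i => (hb.1 i).le

/-- The centred unit cube with faces orthogonal to the frame. -/
def cubeSet (b : OrthoFrame) : Set E3 := {x | ∀ i, |(inner ℝ (b.1 i) x : ℝ)| ≤ 1 / 2}

theorem sq_norm_le_of_mem_cubeSet {b : OrthoFrame} {x : E3} (hx : x ∈ b.cubeSet) :
    ‖x‖ ^ 2 ≤ 3 / 4 := by
  rw [← b.sum_sq_inner, Fin.sum_univ_three]
  have h : ∀ i, (inner ℝ (b.1 i) x : ℝ) ^ 2 ≤ 1 / 4 := fun i => by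
    rw [← sq_abs]; nlinarith [hx i, abs_nonneg (inner ℝ (b.1 i) x : ℝ)]
  linarith [h 0, h 1, h 2]

theorem isCompact_cubeSet (b : OrthoFrame) : IsCompact b.cubeSet := by
  refine Metric.isCompact_of_isClosed_isBounded ?_ ?_
  · have h : b.cubeSet = ⋂ i, {x | |(inner ℝ (b.1 i) x : ℝ)| ≤ 1 / 2} := by
      ext x; simp [cubeSet]
    rw [h]
    refine isClosed_iInter fun i => isClosed_le ?_ continuous_const
    fun_prop
  · refine (Metric.isBounded_closedBall (x := (0 : E3)) (r := 1)).subset fun x hx => ?_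
    rw [mem_closedBall_zero_iff]
    have := sq_norm_le_of_mem_cubeSet hx
    nlinarith [norm_nonneg x]

/-- The cube of a frame, as a point of the space of cubes. -/
noncomputable def cube (b : OrthoFrame) : CentredUnitCubes :=
  ⟨⟨⟨b.cubeSet, b.isCompact_cubeSet⟩, ⟨0, by simp [cubeSet]⟩⟩,
    ⟨b.basis, by simp [cubeSet, basis_apply]⟩⟩

theorem coe_cube (b : OrthoFrame) : ((b.cube).1 : Set E3) = b.cubeSet := rfl

theorem cube_eq_cube_iff {b b' : OrthoFrame} : b.cube = b'.cube ↔ b.cubeSet = b'.cubeSet := by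
  rw [← coe_cube, ← coe_cube, SetLike.coe_set_eq, Subtype.ext_iff]

theorem cube_surjective : Function.Surjective cube := by
  rintro ⟨K, b, hb⟩
  refine ⟨⟨b, b.orthonormal⟩, Subtype.ext (SetLike.coe_injective ?_)⟩
  rw [hb, coe_cube]
  rfl

/-- Take y with the same coordinates in the second frame. This bounds the Hausdorff distance of the
cubes by the distances between frame vectors. -/
theorem exists_mem_cubeSet_dist_le (b b' : OrthoFrame) {x : E3} (hx : x ∈ b.cubeSet) :
    ∃ y ∈ b'.cubeSet, dist x y ≤ ∑ i, dist (b.1 i) (b'.1 i) := by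
  refine ⟨∑ i, (inner ℝ (b.1 i) x : ℝ) • b'.1 i, fun i => ?_, ?_⟩
  · have h : (inner ℝ (b'.1 i) (∑ i, (inner ℝ (b.1 i) x : ℝ) • b'.1 i) : ℝ) =
        inner ℝ (b.1 i) x := by
      simp [inner_sum, real_inner_smul_right, inner_eq]
    rw [h]; exact hx i
  · conv_lhs => rw [← b.sum_inner_smul x]
    refine (dist_sum_sum_le Finset.univ _ _).trans (Finset.sum_le_sum fun i _ => ?_)
    rw [sum_inner_smul, dist_smul₀]
    have h := hx i
    rw [Real.norm_eq_abs]
    nlinarith [dist_nonneg (x := b.1 i) (y := b'.1 i)]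

theorem continuous_cube : Continuous cube := by
  refine continuous_induced_rng.2 (continuous_iff_continuousAt.2 fun b => ?_)
  refine tendsto_iff_dist_tendsto_zero.2 ?_
  have h1 : Filter.Tendsto (fun b' : OrthoFrame => ∑ i, dist (b'.1 i) (b.1 i)) (nhds b)
      (nhds 0) := by
    have : Continuous fun b' : OrthoFrame => ∑ i, dist (b'.1 i) (b.1 i) :=
      continuous_finsetSum _ fun i _ =>
        ((continuous_apply i).comp continuous_subtype_val).dist continuous_const
    simpa using this.tendsto b
  refine squeeze_zero (fun _ => dist_nonneg) (fun b' => ?_) h1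
  rw [Metric.NonemptyCompacts.dist_eq]
  refine Metric.hausdorffDist_le_of_mem_dist (Finset.sum_nonneg fun _ _ => dist_nonneg)
    (fun x hx => b'.exists_mem_cubeSet_dist_le b hx) (fun x hx => ?_)
  simp only [dist_comm (b'.1 _)]
  exact b.exists_mem_cubeSet_dist_le b' hx

/-- A continuous map from a compact space to a Hausdorff one is closed. -/
theorem isQuotientMap_cube : Topology.IsQuotientMap cube :=
  continuous_cube.isClosedMap.isQuotientMap continuous_cube cube_surjective

end OrthoFrame

/-! ### Frame operators and tight frames. -/

section TightFrame

variable {p : ℕ}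

/-- The frame operator `x ↦ ∑ i, ⟪w i, x⟫ w i` of a tuple of vectors. -/
noncomputable def frameOp (w : Fin p → E3) : E3 →L[ℝ] E3 :=
  ∑ i, (innerSL ℝ (w i)).smulRight (w i)

theorem frameOp_apply (w : Fin p → E3) (x : E3) :
    frameOp w x = ∑ i, (inner ℝ (w i) x : ℝ) • w i := by
  simp [frameOp]

theorem continuous_frameOp : Continuous (frameOp (p := p)) := by
  refine continuous_clm_apply.2 fun x => ?_
  simp only [frameOp_apply]
  fun_prop

theorem inner_frameOp_self (w : Fin p → E3) (x : E3) :
    (inner ℝ (frameOp w x) x : ℝ) = ∑ i, (inner ℝ (w i) x : ℝ) ^ 2 := by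
  rw [frameOp_apply, sum_inner]
  exact Finset.sum_congr rfl fun i _ => by rw [real_inner_smul_left, sq]

/-- The quadratic form is ∑ ⟪w i, x⟫², which vanishes only when x is orthogonal to a spanning set.
-/
theorem isPosDef_frameOp {w : Fin p → E3} {e : Fin 3 → Fin p}
    (he : LinearIndependent ℝ fun i => w (e i)) : (frameOp w).IsPosDef := by
  refine ⟨(ContinuousLinearMap.isPositive_iff _).2 ⟨fun x y => ?_, fun x => ?_⟩, fun x hx => ?_⟩
  · simp only [ContinuousLinearMap.coe_coe]
    rw [frameOp_apply, frameOp_apply, sum_inner, inner_sum]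
    refine Finset.sum_congr rfl fun i _ => ?_
    rw [real_inner_smul_left, real_inner_smul_right, real_inner_comm x (w i)]
    ring
  · rw [inner_frameOp_self]; positivity
  · rw [inner_frameOp_self]
    refine (Finset.sum_nonneg fun i _ => sq_nonneg _).lt_of_ne fun h => hx ?_
    have h0 : ∀ i, (inner ℝ (w i) x : ℝ) = 0 := fun i => by
      have := (Finset.sum_eq_zero_iff_of_nonneg fun i _ => sq_nonneg _).1 h.symm i
        (Finset.mem_univ i)
      exact pow_eq_zero_iff two_ne_zero |>.1 this
    have hspan := he.span_eq_top_of_card_eq_finrank' (by simp)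
    have hx0 : x ∈ (Submodule.span ℝ (Set.range fun i => w (e i))) := hspan ▸ Submodule.mem_top
    have : ∀ y ∈ Submodule.span ℝ (Set.range fun i => w (e i)), (inner ℝ y x : ℝ) = 0 := by
      intro y hy
      induction hy using Submodule.span_induction with
      | mem y hy => obtain ⟨i, rfl⟩ := hy; exact h0 _
      | zero => simp
      | add y z _ _ hy hz => rw [inner_add_left, hy, hz, add_zero]
      | smul c y _ hy => rw [real_inner_smul_left, hy, mul_zero]
    exact inner_self_eq_zero.1 (this x hx0)

/-- The tight frame associated to a frame by the inverse square root of its frame operator. -/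
noncomputable def tight (w : Fin p → E3) (i : Fin p) : E3 := (frameOp w).invSqrt (w i)

/-- This is S^(-1/2) S S^(-1/2) = 1, with one factor moved across the inner product by symmetry. -/
theorem frameOp_tight {w : Fin p → E3} (hw : (frameOp w).IsPosDef) (x : E3) :
    ∑ i, (inner ℝ (tight w i) x : ℝ) • tight w i = x := by
  have h : ∀ i, (inner ℝ (tight w i) x : ℝ) = inner ℝ (w i) ((frameOp w).invSqrt x) := fun i =>
    hw.invSqrt.1.isSymmetric _ _
  conv_rhs => rw [← hw.invSqrt_apply_apply x, frameOp_apply, map_sum]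
  simp only [h, map_smul]
  rfl

theorem linearIndependent_tight {w : Fin p → E3} (hw : (frameOp w).IsPosDef) {e : Fin 3 → Fin p}
    (he : LinearIndependent ℝ fun i => w (e i)) : LinearIndependent ℝ fun i => tight w (e i) :=
  he.map' ((frameOp w).invSqrt : E3 →ₗ[ℝ] E3) (LinearMap.ker_eq_bot.2 hw.invSqrt.injective)

theorem frameOp_signed_perm {w w' : Fin p → E3} (σ : Equiv.Perm (Fin p)) (s : Fin p → ℝ)
    (hs : ∀ i, s i * s i = 1) (h : ∀ i, w i = s i • w' (σ i)) : frameOp w = frameOp w' := by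
  ext1 x
  rw [frameOp_apply, frameOp_apply, ← Equiv.sum_comp σ fun i => (inner ℝ (w' i) x : ℝ) • w' i]
  refine Finset.sum_congr rfl fun i _ => ?_
  rw [h, real_inner_smul_left, smul_smul, mul_right_comm, hs, one_mul]

theorem tight_signed_perm {w w' : Fin p → E3} (σ : Equiv.Perm (Fin p)) (s : Fin p → ℝ)
    (hs : ∀ i, s i * s i = 1) (h : ∀ i, w i = s i • w' (σ i)) (i : Fin p) :
    tight w i = s i • tight w' (σ i) := by
  rw [tight, tight, frameOp_signed_perm σ s hs h, h, map_smul]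

theorem tight_of_frameOp_eq_one {w : Fin p → E3} (hw : frameOp w = 1) : tight w = w := by
  ext1 i
  rw [tight, hw, ContinuousLinearMap.invSqrt_one]
  rfl

theorem continuous_tight {X : Type*} [TopologicalSpace X] {w : X → Fin p → E3}
    (hw : Continuous w) (hpos : ∀ x, (frameOp (w x)).IsPosDef) (i : Fin p) :
    Continuous fun x => tight (w x) i :=
  (ContinuousLinearMap.continuousOn_invSqrt.comp_continuous (continuous_frameOp.comp hw)
    hpos).clm_apply ((continuous_apply i).comp hw)

end TightFrame

/-! ### The homotopy equivalence from compatible data on lifts. -/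

theorem Topology.IsQuotientMap.exists_continuousMap {X Y Z : Type*} [TopologicalSpace X]
    [TopologicalSpace Y] [TopologicalSpace Z] {q : X → Y} (hq : Topology.IsQuotientMap q)
    {f : X → Z} (hf : Continuous f) (h : ∀ a b, q a = q b → f a = f b) :
    ∃ g : C(Y, Z), ∀ x, g (q x) = f x := by
  have hg : ∀ x, f (Function.surjInv hq.surjective (q x)) = f x := fun x =>
    h _ _ (Function.surjInv_eq hq.surjective _)
  exact ⟨⟨fun y => f (Function.surjInv hq.surjective y),
    hq.continuous_iff.2 (hf.congr fun x => (hg x).symm)⟩, hg⟩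

/-- Acting by a positive definite operator depending continuously on the configuration is
homotopic to the identity. -/
theorem GenericConf.homotopic_id_of_eq_act {p : ℕ} (hp : 3 ≤ p) {R : GenericConf p → E3 →L[ℝ] E3}
    (hRcont : Continuous R) (hRpos : ∀ c, (R c).IsPosDef) {g : C(GenericConf p, GenericConf p)}
    (hg : ∀ c, g c = GenericConf.act hp ⟨R c, (hRpos c).injective⟩ c) :
    (ContinuousMap.id (GenericConf p)).Homotopic g := by
  obtain ⟨T, hT, hT1⟩ : ∃ T : unitInterval × GenericConf p →
      {T : E3 →L[ℝ] E3 // Function.Injective T}, Continuous T ∧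
      ∀ x, (T x).1 = (1 - x.1.1) • (1 : E3 →L[ℝ] E3) + x.1.1 • R x.2 :=
    ⟨fun x => ⟨_, ((hRpos x.2).segment x.1.2.1 x.1.2.2).injective⟩,
      Continuous.subtype_mk (by fun_prop) _, fun _ => rfl⟩
  have hcont : Continuous fun x : unitInterval × GenericConf p => act hp (T x) x.2 :=
    (GenericConf.continuous_act hp).comp (hT.prodMk continuous_snd)
  have h0 : ∀ c, act hp (T (0, c)) c = c := fun c =>
    act_one hp _ (ContinuousLinearMap.ext fun v => by rw [hT1]; simp) c
  have h1 : ∀ c, act hp (T (1, c)) c = g c := fun c => by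
    have h : T (1, c) = ⟨R c, (hRpos c).injective⟩ := Subtype.ext
      (ContinuousLinearMap.ext fun v => by rw [hT1]; simp)
    rw [hg, h]
  exact ⟨⟨⟨_, hcont⟩, h0, h1⟩⟩

/-- A continuous choice `w` of representatives of the lines of a configuration, well defined up to
signs and order, together with compatible continuous maps to and from orthonormal frames, yields a
homotopy equivalence with the space of cubes. -/
theorem nonempty_homotopyEquiv_cubes {p : ℕ} (hp : 3 ≤ p) (w : GenVec p → Fin p → E3)
    (hw : Continuous w) (hpos : ∀ a, (frameOp (w a)).IsPosDef)
    (hw_smul : ∀ a i, ∃ k : ℝˣ, w a i = k • a.vec i)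
    (hw_perm : ∀ a b : GenVec p, a.conf = b.conf → ∃ (σ : Equiv.Perm (Fin p)) (s : Fin p → ℝ),
      (∀ i, s i * s i = 1) ∧ ∀ i, w a i = s i • w b (σ i))
    (frame : GenVec p → OrthoFrame) (hframe : Continuous frame)
    (hframe_perm : ∀ a b : GenVec p, a.conf = b.conf → (frame a).cube = (frame b).cube)
    (axes : OrthoFrame → GenVec p) (haxes : Continuous axes)
    (haxes_perm : ∀ b b' : OrthoFrame, b.cube = b'.cube → (axes b).conf = (axes b').conf)
    (hcube : ∀ b, (frame (axes b)).cube = b.cube)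
    (htight : ∀ a, (axes (frame a)).vec = tight (w a)) :
    Nonempty (GenericConf p ≃ₕ CentredUnitCubes) := by
  have hq := (GenVec.isOpenQuotientMap_conf (p := p))
  have hsurj := hq.surjective
  obtain ⟨R, hRconf⟩ : ∃ R : C(GenericConf p, E3 →L[ℝ] E3),
      ∀ a : GenVec p, R a.conf = (frameOp (w a)).invSqrt := by
    refine hq.isQuotientMap.exists_continuousMap
      (ContinuousLinearMap.continuousOn_invSqrt.comp_continuous (continuous_frameOp.comp hw)
        hpos) fun a b hab => ?_
    obtain ⟨σ, s, hs, h⟩ := hw_perm a b hab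
    exact congrArg _ (frameOp_signed_perm σ s hs h)
  have hRpos : ∀ c, (R c).IsPosDef := fun c => by
    obtain ⟨a, rfl⟩ := hsurj c
    rw [hRconf]
    exact (hpos a).invSqrt
  obtain ⟨F, hF⟩ := hq.isQuotientMap.exists_continuousMap
    (OrthoFrame.continuous_cube.comp hframe) hframe_perm
  obtain ⟨G, hG⟩ := OrthoFrame.isQuotientMap_cube.exists_continuousMap
    (hq.continuous.comp haxes) haxes_perm
  simp only [Function.comp_apply] at hF hG
  have hFG : F.comp G = ContinuousMap.id _ := by
    ext1 K
    obtain ⟨b, rfl⟩ := OrthoFrame.cube_surjective K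
    rw [ContinuousMap.comp_apply, hG, hF, hcube, ContinuousMap.id_apply]
  have hGF : ∀ c, G (F c) = GenericConf.act hp ⟨R c, (hRpos c).injective⟩ c := fun c => by
    obtain ⟨a, rfl⟩ := hsurj c
    rw [hF, hG, GenericConf.act_conf]
    choose k hk using hw_smul a
    -- The operator acts on `a.vec` rather than `w a`; the scalars relating them pass through it and
    -- do not change the lines.
    refine GenVec.conf_eq_iff.2 ⟨Equiv.refl _, k, fun i => ?_⟩
    rw [htight, GenVec.vec_act, Equiv.refl_apply]
    simp only [hRconf, tight]
    rw [hk, Units.smul_def, Units.smul_def, map_smul]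
  have hH := GenericConf.homotopic_id_of_eq_act hp R.continuous hRpos (g := G.comp F) hGF
  exact ⟨⟨F, G, hH.symm, hFG ▸ ContinuousMap.Homotopic.refl _⟩⟩

theorem GenVec.linearIndependent_of_smul {p : ℕ} (a : GenVec p) {w : Fin p → E3}
    (hw : ∀ i, ∃ k : ℝˣ, w i = k • a.vec i) {e : Fin 3 → Fin p} (he : Function.Injective e) :
    LinearIndependent ℝ fun i => w (e i) := by
  choose k hk using hw
  convert (a.linearIndependent he).units_smul fun i => k (e i) using 1
  ext1 i
  exact hk _

/-- Expand u j by the hypothesis and compare coefficients with the trivial expansion. -/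
theorem orthonormal_of_linearIndependent_of_sum_inner_smul {u : Fin 3 → E3}
    (hli : LinearIndependent ℝ u) (hu : ∀ x, ∑ i, (inner ℝ (u i) x : ℝ) • u i = x) :
    Orthonormal ℝ u := by
  rw [orthonormal_iff_ite]
  intro i j
  have h : ∑ k, ((inner ℝ (u k) (u j) : ℝ) - if k = j then 1 else 0) • u k = 0 := by
    simp only [sub_smul, Finset.sum_sub_distrib, hu, ite_smul, one_smul, zero_smul,
      Finset.sum_ite_eq', Finset.mem_univ, if_true, sub_self]
  have := Fintype.linearIndependent_iff.1 hli _ h i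
  linarith

/-! ### Three points and the axes of a cube. -/

namespace OrthoFrame

theorem frameOp_eq_one (b : OrthoFrame) : frameOp b.1 = 1 := by
  ext1 x
  rw [frameOp_apply, b.sum_inner_smul]
  rfl

theorem exists_genVec_eq (b : OrthoFrame) : ∃ a : GenVec 3, a.vec = b.1 :=
  GenVec.exists_vec_eq le_rfl _ fun e he => b.2.linearIndependent.comp e he

/-- The axes of an orthonormal frame. -/
noncomputable def axes (b : OrthoFrame) : GenVec 3 := b.exists_genVec_eq.choose

theorem vec_axes (b : OrthoFrame) : b.axes.vec = b.1 := b.exists_genVec_eq.choose_spec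

theorem continuous_axes : Continuous axes := by
  refine GenVec.continuous_iff.2 fun i => ?_
  simp only [vec_axes]
  exact (continuous_apply i).comp continuous_subtype_val

/-- The maximum of ⟪y, ·⟫ on the cube is half the ℓ¹ norm of the coordinates c of y. So ∑ |c i| ≤ 1
= ∑ |c i|², which leaves a single nonzero coordinate, equal to ±1. -/
theorem eq_or_eq_neg_of_forall_inner_le (b : OrthoFrame) {y : E3} (hy : ‖y‖ = 1)
    (h : ∀ x ∈ b.cubeSet, (inner ℝ y x : ℝ) ≤ 1 / 2) : ∃ i, y = b.1 i ∨ y = -b.1 i := by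
  set c : Fin 3 → ℝ := fun i => inner ℝ (b.1 i) y with hc
  have hsq : ∑ i, |c i| ^ 2 = 1 := by
    have := b.sum_sq_inner y
    rw [hy, one_pow] at this
    simpa only [sq_abs] using this
  have habs : ∑ i, |c i| ≤ 1 := by
    -- This point of the cube maximizes ⟪y, ·⟫; coordinates where c vanishes are set to 0.
    have hx : ∑ i, (SignType.sign (c i) / 2 : ℝ) • b.1 i ∈ b.cubeSet := fun j => by
      have : (inner ℝ (b.1 j) (∑ i, (SignType.sign (c i) / 2 : ℝ) • b.1 i) : ℝ) =
          SignType.sign (c j) / 2 := by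
        simp [inner_sum, real_inner_smul_right, inner_eq]
      rw [this]
      rcases lt_trichotomy (c j) 0 with h0 | h0 | h0 <;> simp [h0, abs_div]
    have h1 := h _ hx
    have h2 : (inner ℝ y (∑ i, (SignType.sign (c i) / 2 : ℝ) • b.1 i) : ℝ) =
        (∑ i, |c i|) / 2 := by
      rw [inner_sum, Finset.sum_div]
      refine Finset.sum_congr rfl fun i _ => ?_
      rw [real_inner_smul_right, real_inner_comm, div_mul_eq_mul_div]
      congr 1
      exact sign_mul_self _
    rw [h2] at h1
    linarith
  have hle : ∀ i, |c i| ≤ 1 := fun i =>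
    (Finset.single_le_sum (fun j _ => abs_nonneg (c j)) (Finset.mem_univ i)).trans habs
  obtain ⟨i, hi⟩ : ∃ i, c i ≠ 0 := by
    by_contra! h0
    simp [h0] at hsq
  have hone : |c i| = 1 := by
    refine le_antisymm (hle i) ?_
    by_contra! hlt
    have h3 : ∑ j, |c j| ^ 2 < ∑ j, |c j| := by
      refine Finset.sum_lt_sum (fun j _ => ?_) ⟨i, Finset.mem_univ i, ?_⟩
      · nlinarith [hle j, abs_nonneg (c j)]
      · nlinarith [abs_pos.2 hi]
    linarith
  have hyi : ‖y - c i • b.1 i‖ ^ 2 = 0 := by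
    rw [norm_sub_sq_real, real_inner_smul_right, norm_smul, hy, b.2.1, real_inner_comm,
      Real.norm_eq_abs, hone]
    change 1 ^ 2 - 2 * (c i * c i) + (1 * 1) ^ 2 = 0
    rw [← abs_mul_abs_self (c i), hone]
    norm_num
  have hyeq : y = c i • b.1 i := by
    rw [← sub_eq_zero, ← norm_eq_zero]
    exact pow_eq_zero_iff two_ne_zero |>.1 hyi
  refine ⟨i, ?_⟩
  rcases eq_or_eq_neg_of_abs_eq hone with h1 | h1
  · left; rw [hyeq, h1, one_smul]
  · right; rw [hyeq, h1, neg_one_smul]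

/-- The right-hand side mentions the frame only through its cube, so the axes depend on the cube
alone. -/
theorem mem_conf_axes_iff (b : OrthoFrame) (x : RP2) : x ∈ b.axes.conf.1.1 ↔
    ∃ (y : E3) (hy : y ≠ 0), ‖y‖ = 1 ∧ (∀ z ∈ b.cubeSet, (inner ℝ y z : ℝ) ≤ 1 / 2) ∧
      Projectivization.mk ℝ y hy = x := by
  rw [GenVec.mem_conf]
  constructor
  · rintro ⟨i, rfl⟩
    refine ⟨b.axes.vec i, b.axes.vec_ne_zero i, ?_, fun z hz => ?_, rfl⟩
    · rw [vec_axes, b.2.1]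
    · rw [vec_axes]; exact (le_abs_self _).trans (hz i)
  · rintro ⟨y, hy, hy1, h, rfl⟩
    obtain ⟨i, hi⟩ := b.eq_or_eq_neg_of_forall_inner_le hy1 h
    refine ⟨i, (Projectivization.mk_eq_mk_iff' ℝ _ _ _ _).2 ?_⟩
    rw [vec_axes]
    rcases hi with rfl | rfl
    · exact ⟨1, one_smul _ _⟩
    · exact ⟨-1, by simp⟩

theorem conf_axes_eq_of_cube_eq {b b' : OrthoFrame} (h : b.cube = b'.cube) :
    b.axes.conf = b'.axes.conf := by
  refine Subtype.ext (Subtype.ext (Finset.ext fun x => ?_))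
  rw [mem_conf_axes_iff, mem_conf_axes_iff, cube_eq_cube_iff.1 h]

end OrthoFrame

namespace GenVec

/-- The unit vectors of a generic tuple. -/
noncomputable def unitVec {p : ℕ} (a : GenVec p) (i : Fin p) : E3 := ‖a.vec i‖⁻¹ • a.vec i

theorem continuous_unitVec {p : ℕ} : Continuous (unitVec (p := p)) :=
  continuous_pi fun i => ((continuous_vec i).norm.inv₀ fun a =>
    norm_ne_zero_iff.2 (a.vec_ne_zero i)).smul (continuous_vec i)

theorem exists_unitVec_eq {p : ℕ} (a : GenVec p) (i : Fin p) :
    ∃ k : ℝˣ, a.unitVec i = k • a.vec i :=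
  ⟨Units.mk0 _ (inv_ne_zero (norm_ne_zero_iff.2 (a.vec_ne_zero i))), rfl⟩

theorem unitVec_perm {p : ℕ} {a b : GenVec p} (h : a.conf = b.conf) :
    ∃ (σ : Equiv.Perm (Fin p)) (s : Fin p → ℝ),
      (∀ i, s i * s i = 1) ∧ ∀ i, a.unitVec i = s i • b.unitVec (σ i) := by
  obtain ⟨σ, l, hl⟩ := conf_eq_iff.1 h
  -- Normalizing leaves only the sign l / |l| of each scalar.
  refine ⟨σ, fun i => |(l i : ℝ)|⁻¹ * l i, fun i => ?_, fun i => ?_⟩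
  · have : (l i : ℝ) ≠ 0 := (l i).ne_zero
    dsimp only
    rcases abs_choice (l i : ℝ) with h | h <;> rw [h] <;> field_simp
  · rw [unitVec, unitVec, hl, Units.smul_def, norm_smul, mul_inv, Real.norm_eq_abs, smul_smul,
      smul_smul]
    congr 1
    ring

theorem isPosDef_unitVec (a : GenVec 3) : (frameOp a.unitVec).IsPosDef :=
  isPosDef_frameOp (a.linearIndependent_of_smul a.exists_unitVec_eq Function.injective_id)

/-- The orthonormal frame obtained by symmetric orthonormalization of a generic triple. -/
noncomputable def orthoFrame (a : GenVec 3) : OrthoFrame :=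
  ⟨tight a.unitVec, orthonormal_of_linearIndependent_of_sum_inner_smul
    (linearIndependent_tight a.isPosDef_unitVec
      (a.linearIndependent_of_smul a.exists_unitVec_eq Function.injective_id))
    (frameOp_tight a.isPosDef_unitVec)⟩

theorem cube_orthoFrame_eq {a b : GenVec 3} (h : a.conf = b.conf) :
    a.orthoFrame.cube = b.orthoFrame.cube := by
  obtain ⟨σ, s, hs, hab⟩ := unitVec_perm h
  rw [OrthoFrame.cube_eq_cube_iff]
  ext x
  have h1 : ∀ i, |(inner ℝ (tight a.unitVec i) x : ℝ)| =
      |(inner ℝ (tight b.unitVec (σ i)) x : ℝ)| := fun i => by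
    have : |s i| = 1 := by
      have := abs_mul_abs_self (s i)
      rw [hs] at this
      nlinarith [abs_nonneg (s i)]
    rw [tight_signed_perm σ s hs hab, real_inner_smul_left, abs_mul, this, one_mul]
  change (∀ i, |(inner ℝ (tight a.unitVec i) x : ℝ)| ≤ 1 / 2) ↔
    ∀ i, |(inner ℝ (tight b.unitVec i) x : ℝ)| ≤ 1 / 2
  simp only [h1]
  exact σ.forall_congr_right (q := fun i => |(inner ℝ (tight b.unitVec i) x : ℝ)| ≤ 1 / 2)

theorem orthoFrame_axes (b : OrthoFrame) : b.axes.orthoFrame = b := by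
  have h : b.axes.unitVec = b.1 := funext fun i => by
    rw [unitVec, OrthoFrame.vec_axes, b.2.1, inv_one, one_smul]
  refine Subtype.ext ?_
  change tight b.axes.unitVec = b.1
  rw [h, tight_of_frameOp_eq_one b.frameOp_eq_one]

end GenVec

theorem nonempty_genericConf_three_homotopyEquiv_cubes :
    Nonempty (GenericConf 3 ≃ₕ CentredUnitCubes) :=
  nonempty_homotopyEquiv_cubes le_rfl GenVec.unitVec GenVec.continuous_unitVec
    GenVec.isPosDef_unitVec GenVec.exists_unitVec_eq (fun _ _ => GenVec.unitVec_perm)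
    GenVec.orthoFrame
    (Continuous.subtype_mk (continuous_pi fun i =>
      continuous_tight GenVec.continuous_unitVec GenVec.isPosDef_unitVec i) _)
    (fun _ _ => GenVec.cube_orthoFrame_eq) OrthoFrame.axes OrthoFrame.continuous_axes
    (fun _ _ => OrthoFrame.conf_axes_eq_of_cube_eq)
    (fun b => by rw [GenVec.orthoFrame_axes]) (fun a => OrthoFrame.vec_axes _)

/-! ### Linear relations between four vectors. -/

section Relations

/-- The coefficients of the linear relation between four vectors of 3-space given by Cramer's
rule. -/
noncomputable def relCoeff (v : Fin 4 → E3) (k : Fin 4) : ℝ :=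
  (-1) ^ (k : ℕ) * (Matrix.of fun i j : Fin 3 => v (k.succAbove i) j).det

/-- Each coordinate is the expansion of a 4 × 4 determinant with a repeated column. -/
theorem sum_relCoeff_smul (v : Fin 4 → E3) : ∑ k, relCoeff v k • v k = 0 := by
  have h10 : (1 : Fin 4).succAbove 0 = 0 := rfl
  have h11 : (1 : Fin 4).succAbove 1 = 2 := rfl
  have h12 : (1 : Fin 4).succAbove 2 = 3 := rfl
  have h20 : (2 : Fin 4).succAbove 0 = 0 := rfl
  have h21 : (2 : Fin 4).succAbove 1 = 1 := rfl
  have h22 : (2 : Fin 4).succAbove 2 = 3 := rfl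
  have h30 : (3 : Fin 4).succAbove 0 = 0 := rfl
  have h31 : (3 : Fin 4).succAbove 1 = 1 := rfl
  have h32 : (3 : Fin 4).succAbove 2 = 2 := rfl
  have h00 : (0 : Fin 4).succAbove 0 = 1 := rfl
  have h01 : (0 : Fin 4).succAbove 1 = 2 := rfl
  have h02 : (0 : Fin 4).succAbove 2 = 3 := rfl
  ext j
  simp only [relCoeff, Fin.sum_univ_four, Matrix.det_fin_three, Matrix.of_apply, h00, h01, h02,
    h10, h11, h12, h20, h21, h22, h30, h31, h32, PiLp.add_apply, PiLp.smul_apply, smul_eq_mul,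
    PiLp.zero_apply]
  fin_cases j <;> simp only [Fin.zero_eta, Fin.mk_one, Fin.reduceFinMk] <;> norm_num <;> ring

theorem relCoeff_ne_zero {v : Fin 4 → E3} {k : Fin 4}
    (h : LinearIndependent ℝ fun i => v (k.succAbove i)) : relCoeff v k ≠ 0 := by
  refine mul_ne_zero (pow_ne_zero _ (by norm_num)) ?_
  have h2 : LinearIndependent ℝ (Matrix.of fun i j : Fin 3 => v (k.succAbove i) j).row :=
    h.map' (WithLp.linearEquiv 2 ℝ (Fin 3 → ℝ) : E3 →ₗ[ℝ] Fin 3 → ℝ) (LinearEquiv.ker _)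
  rw [Matrix.linearIndependent_rows_iff_isUnit] at h2
  exact ((Matrix.isUnit_iff_isUnit_det _).1 h2).ne_zero

theorem continuous_relCoeff (k : Fin 4) : Continuous fun v : Fin 4 → E3 => relCoeff v k := by
  unfold relCoeff
  refine continuous_const.mul (Continuous.matrix_det ?_)
  refine continuous_matrix fun i j => ?_
  simp only [Matrix.of_apply]
  fun_prop

/-- Subtracting c 0 times the relation ∑ w i = 0 leaves a relation among three independent vectors.
-/
theorem eq_of_sum_smul_eq_zero {w : Fin 4 → E3} (hli : LinearIndependent ℝ fun i => w (Fin.succ i))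
    (hw : ∑ i, w i = 0) {c : Fin 4 → ℝ} (hc : ∑ i, c i • w i = 0) (i : Fin 4) : c i = c 0 := by
  have h : ∑ i, (c i - c 0) • w i = 0 := by
    simp only [sub_smul, Finset.sum_sub_distrib, hc, ← Finset.smul_sum, hw, smul_zero, sub_zero]
  rw [Fin.sum_univ_succ, sub_self, zero_smul, zero_add] at h
  have := Fintype.linearIndependent_iff.1 hli _ h
  refine Fin.cases rfl (fun j => ?_) i
  linarith [this j]

end Relations

/-! ### Tetrahedral quadruples and their cubes. -/

/-- Four vectors spanning the diagonals of a centred unit cube. -/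
def IsTetrahedral (u : Fin 4 → E3) : Prop :=
  ∑ i, u i = 0 ∧ ∀ i j, (inner ℝ (u i) (u j) : ℝ) = if i = j then 3 / 4 else -1 / 4

namespace IsTetrahedral

variable {u : Fin 4 → E3}

/-- The expansion of u j is a relation with coefficients ⟪u i, u j⟫ - δ_ij, so these do not depend
on i. Their sum over the four indices is -1, hence each is -1/4. -/
theorem of_sum_inner_smul (hli : LinearIndependent ℝ fun i => u (Fin.succ i))
    (hu0 : ∑ i, u i = 0) (hu : ∀ x, ∑ i, (inner ℝ (u i) x : ℝ) • u i = x) :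
    IsTetrahedral u := by
  refine ⟨hu0, ?_⟩
  have h1 : ∀ i j, (inner ℝ (u i) (u j) : ℝ) - (if i = j then 1 else 0) =
      inner ℝ (u 0) (u j) - (if 0 = j then 1 else 0) := fun i j => by
    refine eq_of_sum_smul_eq_zero hli hu0
      (c := fun i => (inner ℝ (u i) (u j) : ℝ) - if i = j then 1 else 0) ?_ i
    simp only [sub_smul, Finset.sum_sub_distrib, hu, ite_smul, one_smul, zero_smul,
      Finset.sum_ite_eq', Finset.mem_univ, if_true, sub_self]
  have h2 : ∀ j, (inner ℝ (u 0) (u j) : ℝ) - (if 0 = j then 1 else 0) = -1 / 4 := fun j => by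
    have h3 : ∑ i, (inner ℝ (u i) (u j) : ℝ) = 0 := by rw [← sum_inner, hu0, inner_zero_left]
    have h4 : ∑ i, ((inner ℝ (u i) (u j) : ℝ) - (if i = j then 1 else 0)) = -1 := by
      rw [Finset.sum_sub_distrib, h3]; simp
    simp only [h1] at h4
    rw [Finset.sum_const, Finset.card_univ, Fintype.card_fin, nsmul_eq_mul] at h4
    push_cast at h4
    linarith
  intro i j
  have h5 := (h1 i j).trans (h2 j)
  split_ifs at h5 ⊢ <;> linarith

theorem linearIndependent (hu : IsTetrahedral u) {e : Fin 3 → Fin 4} (he : Function.Injective e) :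
    LinearIndependent ℝ fun i => u (e i) := by
  refine Fintype.linearIndependent_iff.2 fun c hc => ?_
  have h1 : ∀ j, c j = 1 / 4 * ∑ i, c i := fun j => by
    have h2 : (inner ℝ (∑ i, c i • u (e i)) (u (e j)) : ℝ) = 0 := by rw [hc, inner_zero_left]
    rw [sum_inner] at h2
    have h3 : ∀ i, (inner ℝ (c i • u (e i)) (u (e j)) : ℝ) =
        (if i = j then c i else 0) - 1 / 4 * c i := fun i => by
      rw [real_inner_smul_left, hu.2]
      simp only [he.eq_iff]
      split_ifs <;> ring
    simp only [h3, Finset.sum_sub_distrib, Finset.sum_ite_eq', Finset.mem_univ, if_true,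
      ← Finset.mul_sum] at h2
    linarith
  have h4 : ∑ i, c i = 0 := by
    have h5 : ∑ i, c i = ∑ _i : Fin 3, 1 / 4 * ∑ i, c i := Finset.sum_congr rfl fun j _ => h1 j
    rw [Finset.sum_const, Finset.card_univ, Fintype.card_fin, nsmul_eq_mul] at h5
    push_cast at h5
    linarith
  intro j
  rw [h1, h4, mul_zero]

theorem orthonormal (hu : IsTetrahedral u) :
    Orthonormal ℝ ![u 0 + u 1, u 0 + u 2, u 0 + u 3] := by
  rw [orthonormal_iff_ite]
  have h : ∀ i, ![u 0 + u 1, u 0 + u 2, u 0 + u 3] i = u 0 + u (Fin.succ i) := fun i => by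
    fin_cases i <;> rfl
  intro i j
  rw [h, h, inner_add_left, inner_add_right, inner_add_right, hu.2, hu.2, hu.2, hu.2]
  simp only [Fin.succ_inj, Fin.succ_ne_zero, (Fin.succ_ne_zero _).symm, if_true, if_false]
  split_ifs <;> norm_num

/-- The orthonormal frame of the cube with diagonals spanned by a tetrahedral quadruple. -/
noncomputable def frame (hu : IsTetrahedral u) : OrthoFrame := ⟨_, hu.orthonormal⟩

/-- Since ∑ u i = 0, complementary pairs have opposite sums, so all six pair sums are frame vectors
up to sign. This description is symmetric in the four indices. -/
theorem mem_cubeSet_frame (hu : IsTetrahedral u) (x : E3) :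
    x ∈ hu.frame.cubeSet ↔ ∀ i j, i ≠ j → |(inner ℝ (u i + u j) x : ℝ)| ≤ 1 / 2 := by
  have h0 := hu.1
  rw [Fin.sum_univ_four] at h0
  constructor
  · intro hx
    have h01 : |(inner ℝ (u 0 + u 1) x : ℝ)| ≤ 1 / 2 := hx 0
    have h02 : |(inner ℝ (u 0 + u 2) x : ℝ)| ≤ 1 / 2 := hx 1
    have h03 : |(inner ℝ (u 0 + u 3) x : ℝ)| ≤ 1 / 2 := hx 2
    have hs : (inner ℝ (u 0) x : ℝ) + inner ℝ (u 1) x + inner ℝ (u 2) x + inner ℝ (u 3) x = 0 := by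
      rw [← inner_add_left, ← inner_add_left, ← inner_add_left, h0, inner_zero_left]
    rw [inner_add_left, abs_le] at h01 h02 h03
    intro i j hij
    rw [inner_add_left, abs_le]
    fin_cases i <;> fin_cases j <;>
      first
      | exact absurd rfl hij
      | (simp only [Fin.zero_eta, Fin.mk_one, Fin.reduceFinMk]; constructor <;> linarith)
  · intro h i
    fin_cases i
    · exact h 0 1 (by decide)
    · exact h 0 2 (by decide)
    · exact h 0 3 (by decide)

theorem cube_frame_eq (hu : IsTetrahedral u) {v : Fin 4 → E3} (hv : IsTetrahedral v)
    (σ : Equiv.Perm (Fin 4)) {s : ℝ} (hs : s = 1 ∨ s = -1) (h : ∀ i, u i = s • v (σ i)) :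
    hu.frame.cube = hv.frame.cube := by
  rw [OrthoFrame.cube_eq_cube_iff]
  ext x
  rw [mem_cubeSet_frame, mem_cubeSet_frame]
  have h1 : ∀ i j, |(inner ℝ (u i + u j) x : ℝ)| = |(inner ℝ (v (σ i) + v (σ j)) x : ℝ)| :=
    fun i j => by
      rw [h, h, ← smul_add, real_inner_smul_left, abs_mul]
      rcases hs with rfl | rfl <;> simp
  simp only [h1]
  constructor
  · intro H i j hij
    simpa using H (σ.symm i) (σ.symm j) (by simpa using hij)
  · intro H i j hij
    exact H _ _ (by simpa using hij)

end IsTetrahedral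

/-! ### The diagonals of a cube. -/

namespace OrthoFrame

/-- The sign pattern of the diagonals of a cube. -/
def diagSign : Fin 4 → Fin 3 → ℤ := ![![1, 1, 1], ![1, -1, -1], ![-1, 1, -1], ![-1, -1, 1]]

/-- Vectors spanning the diagonals of the cube of an orthonormal frame, with sum zero. -/
noncomputable def diagVec (b : OrthoFrame) (i : Fin 4) : E3 :=
  ∑ j, (diagSign i j / 2 : ℝ) • b.1 j

theorem diagVec_eq (b : OrthoFrame) : b.diagVec =
    ![(1 / 2 : ℝ) • (b.1 0 + b.1 1 + b.1 2), (1 / 2 : ℝ) • (b.1 0 - b.1 1 - b.1 2),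
      (1 / 2 : ℝ) • (-b.1 0 + b.1 1 - b.1 2), (1 / 2 : ℝ) • (-b.1 0 - b.1 1 + b.1 2)] := by
  funext i
  rw [diagVec, Fin.sum_univ_three]
  fin_cases i <;> simp [diagSign] <;> module

theorem inner_diagVec (b : OrthoFrame) (i : Fin 4) (j : Fin 3) :
    (inner ℝ (b.1 j) (b.diagVec i) : ℝ) = diagSign i j / 2 := by
  simp [diagVec, inner_sum, real_inner_smul_right, inner_eq]

theorem continuous_diagVec (i : Fin 4) : Continuous fun b : OrthoFrame => b.diagVec i :=
  continuous_finsetSum _ fun j _ =>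
    have h : Continuous fun b : OrthoFrame => b.1 j :=
      (continuous_apply j).comp continuous_subtype_val
    (continuous_const_smul (diagSign i j / 2 : ℝ)).comp h

theorem isTetrahedral_diagVec (b : OrthoFrame) : IsTetrahedral b.diagVec := by
  refine ⟨?_, fun i j => ?_⟩
  · rw [Fin.sum_univ_four, diagVec_eq]
    dsimp only [Matrix.cons_val]
    module
  · have h : (inner ℝ (b.diagVec i) (b.diagVec j) : ℝ) =
        ((∑ k, diagSign i k * diagSign j k : ℤ) : ℝ) / 4 := by
      conv_lhs => rw [diagVec, sum_inner]
      rw [Int.cast_sum, Finset.sum_div]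
      refine Finset.sum_congr rfl fun k _ => ?_
      rw [real_inner_smul_left, inner_diagVec]
      push_cast
      ring
    have h2 : ∀ i j, ∑ k, diagSign i k * diagSign j k = if i = j then 3 else -1 := by decide
    rw [h, h2]
    split_ifs <;> norm_num

theorem frameOp_diagVec (b : OrthoFrame) : frameOp b.diagVec = 1 := by
  ext1 x
  rw [frameOp_apply, Fin.sum_univ_four, one_apply_eq_self]
  conv_rhs => rw [← b.sum_inner_smul x, Fin.sum_univ_three]
  simp only [diagVec_eq]
  dsimp only [Matrix.cons_val]
  simp only [real_inner_smul_left, inner_add_left, inner_sub_left, inner_neg_left]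
  module

theorem frame_diagVec (b : OrthoFrame) : b.isTetrahedral_diagVec.frame = b := by
  refine Subtype.ext (funext fun i => ?_)
  fin_cases i
  · change b.diagVec 0 + b.diagVec 1 = b.1 0
    simp only [diagVec_eq]; dsimp only [Matrix.cons_val]; module
  · change b.diagVec 0 + b.diagVec 2 = b.1 1
    simp only [diagVec_eq]; dsimp only [Matrix.cons_val]; module
  · change b.diagVec 0 + b.diagVec 3 = b.1 2
    simp only [diagVec_eq]; dsimp only [Matrix.cons_val]; module

theorem _root_.IsTetrahedral.diagVec_frame {u : Fin 4 → E3} (hu : IsTetrahedral u) :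
    hu.frame.diagVec = u := by
  have h0 := hu.1
  rw [Fin.sum_univ_four] at h0
  have h1 : u 3 = -u 0 - u 1 - u 2 := by
    rw [← sub_eq_zero, ← h0]; abel
  rw [OrthoFrame.diagVec_eq]
  funext i
  fin_cases i
  · change (1 / 2 : ℝ) • ((u 0 + u 1) + (u 0 + u 2) + (u 0 + u 3)) = u 0
    rw [h1]; module
  · change (1 / 2 : ℝ) • ((u 0 + u 1) - (u 0 + u 2) - (u 0 + u 3)) = u 1
    rw [h1]; module
  · change (1 / 2 : ℝ) • (-(u 0 + u 1) + (u 0 + u 2) - (u 0 + u 3)) = u 2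
    rw [h1]; module
  · change (1 / 2 : ℝ) • (-(u 0 + u 1) - (u 0 + u 2) + (u 0 + u 3)) = u 3
    rw [h1]; module

theorem exists_genVec_eq_diagVec (b : OrthoFrame) : ∃ a : GenVec 4, a.vec = b.diagVec :=
  GenVec.exists_vec_eq (by norm_num) _ fun _ he => b.isTetrahedral_diagVec.linearIndependent he

/-- The diagonals of the cube of an orthonormal frame. -/
noncomputable def diags (b : OrthoFrame) : GenVec 4 := b.exists_genVec_eq_diagVec.choose

theorem vec_diags (b : OrthoFrame) : b.diags.vec = b.diagVec := b.exists_genVec_eq_diagVec.choose_spec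

theorem continuous_diags : Continuous diags := by
  refine GenVec.continuous_iff.2 fun i => ?_
  simp only [vec_diags]
  exact continuous_diagVec i

/-- Three squared coordinates, each at most 1/4, add up to 3/4, so y is a vertex; the eight vertices
form four antipodal pairs. -/
theorem exists_eq_or_eq_neg_diagVec (b : OrthoFrame) {y : E3} (hy : ‖y‖ ^ 2 = 3 / 4)
    (h : y ∈ b.cubeSet) : ∃ i, y = b.diagVec i ∨ y = -b.diagVec i := by
  have hsq := b.sum_sq_inner y
  rw [hy, Fin.sum_univ_three] at hsq
  have hle : ∀ i, (inner ℝ (b.1 i) y : ℝ) ^ 2 ≤ 1 / 4 := fun i => by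
    rw [← sq_abs]; nlinarith [h i, abs_nonneg (inner ℝ (b.1 i) y : ℝ)]
  have hval : ∀ i, (inner ℝ (b.1 i) y : ℝ) ^ 2 = (1 / 2) ^ 2 := fun i => by
    have h0 := hle 0
    have h1 := hle 1
    have h2 := hle 2
    fin_cases i <;> simp only [Fin.zero_eta, Fin.mk_one, Fin.reduceFinMk] <;> linarith
  have hsgn : ∀ i, (inner ℝ (b.1 i) y : ℝ) = 1 / 2 ∨ (inner ℝ (b.1 i) y : ℝ) = -(1 / 2) :=
    fun i => sq_eq_sq_iff_eq_or_eq_neg.1 (hval i)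
  have hsum := b.sum_inner_smul y
  rw [Fin.sum_univ_three] at hsum
  rw [← hsum]
  have e0 : b.diagVec 0 = (1 / 2 : ℝ) • (b.1 0 + b.1 1 + b.1 2) := by
    rw [diagVec_eq]; rfl
  have e1 : b.diagVec 1 = (1 / 2 : ℝ) • (b.1 0 - b.1 1 - b.1 2) := by
    rw [diagVec_eq]; rfl
  have e2 : b.diagVec 2 = (1 / 2 : ℝ) • (-b.1 0 + b.1 1 - b.1 2) := by
    rw [diagVec_eq]; rfl
  have e3 : b.diagVec 3 = (1 / 2 : ℝ) • (-b.1 0 - b.1 1 + b.1 2) := by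
    rw [diagVec_eq]; rfl
  rcases hsgn 0 with h0 | h0 <;> rcases hsgn 1 with h1 | h1 <;> rcases hsgn 2 with h2 | h2 <;>
    rw [h0, h1, h2]
  · exact ⟨0, .inl (by rw [e0]; module)⟩
  · exact ⟨3, .inr (by rw [e3]; module)⟩
  · exact ⟨2, .inr (by rw [e2]; module)⟩
  · exact ⟨1, .inl (by rw [e1]; module)⟩
  · exact ⟨1, .inr (by rw [e1]; module)⟩
  · exact ⟨2, .inl (by rw [e2]; module)⟩
  · exact ⟨3, .inl (by rw [e3]; module)⟩
  · exact ⟨0, .inr (by rw [e0]; module)⟩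

/-- Diagonals are the lines through the points of the cube farthest from the origin, a condition on
the cube alone. -/
theorem mem_conf_diags_iff (b : OrthoFrame) (x : RP2) : x ∈ b.diags.conf.1.1 ↔
    ∃ (y : E3) (hy : y ≠ 0), ‖y‖ ^ 2 = 3 / 4 ∧ y ∈ b.cubeSet ∧ Projectivization.mk ℝ y hy = x := by
  rw [GenVec.mem_conf]
  constructor
  · rintro ⟨i, rfl⟩
    refine ⟨b.diags.vec i, b.diags.vec_ne_zero i, ?_, fun j => ?_, rfl⟩
    · rw [vec_diags, ← real_inner_self_eq_norm_sq, b.isTetrahedral_diagVec.2, if_pos rfl]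
    · rw [vec_diags]
      have h : ∀ i j, |diagSign i j| = 1 := by decide
      rw [inner_diagVec, abs_div, ← Int.cast_abs, h]
      norm_num
  · rintro ⟨y, hy, hy1, h, rfl⟩
    obtain ⟨i, hi⟩ := b.exists_eq_or_eq_neg_diagVec hy1 h
    refine ⟨i, (Projectivization.mk_eq_mk_iff' ℝ _ _ _ _).2 ?_⟩
    rw [vec_diags]
    rcases hi with rfl | rfl
    · exact ⟨1, one_smul _ _⟩
    · exact ⟨-1, by simp⟩

theorem conf_diags_eq_of_cube_eq {b b' : OrthoFrame} (h : b.cube = b'.cube) :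
    b.diags.conf = b'.diags.conf := by
  refine Subtype.ext (Subtype.ext (Finset.ext fun x => ?_))
  rw [mem_conf_diags_iff, mem_conf_diags_iff, cube_eq_cube_iff.1 h]

end OrthoFrame

/-! ### Four points and their balanced representatives. -/

namespace GenVec

theorem relCoeff_vec_ne_zero (a : GenVec 4) (k : Fin 4) : relCoeff a.vec k ≠ 0 :=
  relCoeff_ne_zero (a.linearIndependent k.succAbove_right_injective)

/-- The sum of squared norms of the balanced but unnormalized representatives. -/
noncomputable def balancedSq (a : GenVec 4) : ℝ := ∑ k, ‖relCoeff a.vec k • a.vec k‖ ^ 2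

theorem balancedSq_pos (a : GenVec 4) : 0 < a.balancedSq := by
  refine Finset.sum_pos (fun k _ => ?_) Finset.univ_nonempty
  have := smul_ne_zero (a.relCoeff_vec_ne_zero k) (a.vec_ne_zero k)
  positivity

/-- The representatives of four points in general position with sum zero, normalized so that their
squared norms add up to `3`. -/
noncomputable def balanced (a : GenVec 4) (k : Fin 4) : E3 :=
  -- The total 3 is that of the four diagonal vectors of a cube, each of squared norm 3/4.
  (√(3 / a.balancedSq) * relCoeff a.vec k) • a.vec k

theorem sum_balanced (a : GenVec 4) : ∑ k, a.balanced k = 0 := by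
  simp only [balanced, mul_smul]
  rw [← Finset.smul_sum, sum_relCoeff_smul, smul_zero]

theorem sum_norm_sq_balanced (a : GenVec 4) : ∑ k, ‖a.balanced k‖ ^ 2 = 3 := by
  have h := a.balancedSq_pos
  have h1 : ∀ k, ‖a.balanced k‖ ^ 2 = 3 / a.balancedSq * ‖relCoeff a.vec k • a.vec k‖ ^ 2 :=
    fun k => by
      rw [balanced, mul_smul, norm_smul, mul_pow, Real.norm_eq_abs, sq_abs,
        Real.sq_sqrt (by positivity)]
  simp only [h1, ← Finset.mul_sum]
  exact div_mul_cancel₀ _ h.ne'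

theorem exists_balanced_eq (a : GenVec 4) (i : Fin 4) : ∃ k : ℝˣ, a.balanced i = k • a.vec i := by
  have h := a.balancedSq_pos
  have h1 : √(3 / a.balancedSq) ≠ 0 := (Real.sqrt_pos.2 (by positivity)).ne'
  exact ⟨Units.mk0 _ (mul_ne_zero h1 (a.relCoeff_vec_ne_zero i)), rfl⟩

theorem continuous_balanced : Continuous balanced := by
  have hv : Continuous (vec (p := 4)) := continuous_pi continuous_vec
  have hc : ∀ k, Continuous fun a : GenVec 4 => relCoeff a.vec k := fun k =>
    (continuous_relCoeff k).comp hv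
  have hsq : Continuous balancedSq :=
    continuous_finsetSum _ fun k _ => (((hc k).smul (continuous_vec k)).norm.pow 2)
  refine continuous_pi fun k => Continuous.smul (Continuous.mul ?_ (hc k)) (continuous_vec k)
  exact Real.continuous_sqrt.comp (continuous_const.div hsq fun a => a.balancedSq_pos.ne')

theorem linearIndependent_balanced (a : GenVec 4) {e : Fin 3 → Fin 4}
    (he : Function.Injective e) : LinearIndependent ℝ fun i => a.balanced (e i) :=
  a.linearIndependent_of_smul a.exists_balanced_eq he

theorem isPosDef_balanced (a : GenVec 4) : (frameOp a.balanced).IsPosDef :=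
  isPosDef_frameOp (a.linearIndependent_balanced (Fin.succ_injective 3))

/-- Uniqueness of the relation makes v a common multiple of the balanced representatives, and the
normalization makes the factor ±1. -/
theorem eq_smul_balanced (a : GenVec 4) {v : Fin 4 → E3} (hv : ∀ i, ∃ k : ℝ, v i = k • a.vec i)
    (h0 : ∑ i, v i = 0) (h3 : ∑ i, ‖v i‖ ^ 2 = 3) :
    ∃ s : ℝ, (s = 1 ∨ s = -1) ∧ ∀ i, v i = s • a.balanced i := by
  have h : ∀ i, ∃ c : ℝ, v i = c • a.balanced i := fun i => by
    obtain ⟨k, hk⟩ := hv i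
    obtain ⟨l, hl⟩ := a.exists_balanced_eq i
    refine ⟨k * (l⁻¹ : ℝˣ), ?_⟩
    rw [hk, hl, mul_smul, ← Units.smul_def, inv_smul_smul]
  choose c hc using h
  have hc0 : ∀ i, c i = c 0 :=
    eq_of_sum_smul_eq_zero (a.linearIndependent_balanced (Fin.succ_injective 3)) a.sum_balanced
      (by simpa only [hc] using h0)
  refine ⟨c 0, ?_, fun i => by rw [hc, hc0]⟩
  have h4 : ∀ i, ‖v i‖ ^ 2 = c 0 ^ 2 * ‖a.balanced i‖ ^ 2 := fun i => by
    rw [hc, hc0, norm_smul, mul_pow, Real.norm_eq_abs, sq_abs]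
  simp only [h4, ← Finset.mul_sum, sum_norm_sq_balanced] at h3
  exact mul_self_eq_one_iff.1 (by linarith)

theorem balanced_perm {a b : GenVec 4} (h : a.conf = b.conf) :
    ∃ (σ : Equiv.Perm (Fin 4)) (s : ℝ), (s = 1 ∨ s = -1) ∧
      ∀ i, a.balanced i = s • b.balanced (σ i) := by
  obtain ⟨σ, l, hl⟩ := conf_eq_iff.1 h
  obtain ⟨s, hs, hab⟩ := b.eq_smul_balanced (v := fun i => a.balanced (σ.symm i))
    (fun i => by
      obtain ⟨k, hk⟩ := a.exists_balanced_eq (σ.symm i)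
      refine ⟨k * l (σ.symm i), ?_⟩
      rw [hk, hl, σ.apply_symm_apply, mul_smul]
      rfl)
    ((Equiv.sum_comp σ.symm a.balanced).trans a.sum_balanced)
    ((Equiv.sum_comp σ.symm fun i => ‖a.balanced i‖ ^ 2).trans a.sum_norm_sq_balanced)
  exact ⟨σ, s, hs, fun i => by simpa using hab (σ i)⟩

theorem isTetrahedral_tight_balanced (a : GenVec 4) : IsTetrahedral (tight a.balanced) := by
  refine IsTetrahedral.of_sum_inner_smul (linearIndependent_tight a.isPosDef_balanced
    (a.linearIndependent_balanced (Fin.succ_injective 3))) ?_ (frameOp_tight a.isPosDef_balanced)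
  simp only [tight]
  rw [← map_sum, sum_balanced, map_zero]

/-- The orthonormal frame of the cube associated to four points in general position. -/
noncomputable def tetraFrame (a : GenVec 4) : OrthoFrame := a.isTetrahedral_tight_balanced.frame

theorem continuous_tetraFrame : Continuous tetraFrame := by
  have h : ∀ i, Continuous fun a : GenVec 4 => tight a.balanced i :=
    continuous_tight continuous_balanced isPosDef_balanced
  refine Continuous.subtype_mk (continuous_pi fun i => ?_) _
  fin_cases i
  · exact (h 0).add (h 1)
  · exact (h 0).add (h 2)
  · exact (h 0).add (h 3)

theorem cube_tetraFrame_eq {a b : GenVec 4} (h : a.conf = b.conf) :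
    a.tetraFrame.cube = b.tetraFrame.cube := by
  obtain ⟨σ, s, hs, hab⟩ := balanced_perm h
  exact IsTetrahedral.cube_frame_eq _ _ σ hs
    (tight_signed_perm σ (fun _ => s) (fun _ => by rcases hs with rfl | rfl <;> norm_num) hab)

/-- The diagonal vectors are already balanced and tight, so they agree with the constructed ones up
to a common sign, which the cube ignores. -/
theorem cube_tetraFrame_diags (b : OrthoFrame) : b.diags.tetraFrame.cube = b.cube := by
  obtain ⟨s, hs, h⟩ := b.diags.eq_smul_balanced (v := b.diagVec)
    (fun i => ⟨1, by rw [OrthoFrame.vec_diags, one_smul]⟩) b.isTetrahedral_diagVec.1 (by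
      simp only [← real_inner_self_eq_norm_sq, b.isTetrahedral_diagVec.2, if_true]
      norm_num)
  have h1 := tight_signed_perm (Equiv.refl _) (fun _ => s)
    (fun _ => by rcases hs with rfl | rfl <;> norm_num) h
  rw [tight_of_frameOp_eq_one b.frameOp_diagVec] at h1
  conv_rhs => rw [← b.frame_diagVec]
  exact (IsTetrahedral.cube_frame_eq b.isTetrahedral_diagVec
    b.diags.isTetrahedral_tight_balanced (Equiv.refl _) hs h1).symm

end GenVec

/-! ### The equivalence for four points and the conclusion. -/

theorem nonempty_genericConf_four_homotopyEquiv_cubes :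
    Nonempty (GenericConf 4 ≃ₕ CentredUnitCubes) :=
  nonempty_homotopyEquiv_cubes (by norm_num) GenVec.balanced GenVec.continuous_balanced
    GenVec.isPosDef_balanced GenVec.exists_balanced_eq
    (fun _ _ h => by
      obtain ⟨σ, s, hs, hab⟩ := GenVec.balanced_perm h
      exact ⟨σ, fun _ => s, fun _ => by rcases hs with rfl | rfl <;> norm_num, hab⟩)
    GenVec.tetraFrame GenVec.continuous_tetraFrame (fun _ _ => GenVec.cube_tetraFrame_eq)
    OrthoFrame.diags OrthoFrame.continuous_diags (fun _ _ => OrthoFrame.conf_diags_eq_of_cube_eq)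
    GenVec.cube_tetraFrame_diags
    (fun a => (OrthoFrame.vec_diags _).trans a.isTetrahedral_tight_balanced.diagVec_frame)

theorem lemma12 :
    Nonempty (GenericConf 3 ≃ₕ GenericConf 4) ∧
    Nonempty (GenericConf 3 ≃ₕ CentredUnitCubes) ∧
    Nonempty (GenericConf 4 ≃ₕ CentredUnitCubes) := by
  obtain ⟨h3⟩ := nonempty_genericConf_three_homotopyEquiv_cubes
  obtain ⟨h4⟩ := nonempty_genericConf_four_homotopyEquiv_cubes
  exact ⟨⟨h3.trans h4.symm⟩, ⟨h3⟩, ⟨h4⟩⟩
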